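/- A (Clifford) ZX diagram $D$ is a finite multigraph (parallel edges and loops allowed) each of whose vertices is a Z-spider or an X-spider with a phase $k\pi/2$, a Hadamard box (of degree $2$) or a boundary vertex (of degree $1$). Its interpretation $[\![D]\!]$ is the linear map (equivalently, the tensor on the boundary qubits) obtained by contracting, along the edges, the Z-spiders $|0\cdots0\rangle+e^{ik\pi/2}|1\cdots1\rangle$, the X-spiders $|{+}\cdots{+}\rangle+e^{ik\pi/2}|{-}\cdots{-}\rangle$ and the Hadamard matrices. Interpretations are compared up to a nonzero scalar, and $\sim$ denotes equality up to a nonzero scalar. An error $\mathcal E$ on $D$ is a set of pairs $(e,t)$ of an edge $e$ of $D$ and a type $t\in\{X,Z\}$; its weight is the number of edges $e$ that occur in it, and $D+\mathcal E$ is the diagram obtained from $D$ by inserting, for every $(e,t)\in\mathcal E$, a two-legged spider of colour $t$ with phase $\pi$ (the Pauli matrix $t$) on the edge $e$. The ZX distance $d(D)\in\mathbb N\cup\{\infty\}$ is the minimum weight of an error $\mathcal E$ with $[\![D+\mathcal E]\!]\not\sim[\![D]\!]$ and $[\![D+\mathcal E]\!]\neq 0$ ($\infty$ if there is none). Let $D_1,D_2$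 be diagrams with the same boundary. The rewrite $D_1\to D_2$ is distance non-decreasing if $[\![D_1]\!]\sim[\![D_2]\!]$ and, for every diagram $D$ in which $D_1$ occurs, the diagram $D'$ obtained from $D$ by replacing this occurrence of $D_1$ by $D_2$ satisfies $d(D)\le d(D')$. It is distance-preserving if both $D_1\to D_2$ and $D_2\to D_1$ are distance non-decreasing. **Theorem.** Let $n$ be even. Let $D_1$ be the $n$-legged Z-spider with phase $0$, and let $D_2$ be the diagram with $n$ boundary legs that consists of two inner Z-spiders with $n/2$ legs each and $n/2$ outer Z-spiders with four legs each, all with phase $0$, where each outer spider is joined by one internal edge to each of the two inner spiders and carries two of the $n$ boundary legs. Then the rewrite $D_1\to D_2$ is distance-preserving. -/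

import Mathlib

/-!
Clifford ZX diagrams as finite open multigraphs, their interpretation, edge-flip errors, the ZX
distance, and distance-preserving rewrites.
-/

namespace ZX

/-- The types of non-boundary vertices: a Z-spider or an X-spider with phase `k * π / 2`
(so that `exp (i k π / 2) = I ^ k`), or a Hadamard box. -/
inductive Node where
  | Z (k : Fin 4)
  | X (k : Fin 4)
  | H

/-- The coefficient of a vertex, with set of legs `L`, at the computational basis labels `x` of its
legs.
* Z-spider: `|0…0⟩ + I ^ k |1…1⟩`.
* X-spider: `|+…+⟩ + I ^ k |-…-⟩`.
* Hadamard box (only used with two legs): the matrix `(1/√2) [[1, 1], [1, -1]]`. -/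
noncomputable def Node.coeff {L : Type} [Fintype L] : Node → (L → Fin 2) → ℂ
  | .Z k, x => (∏ l, if x l = 0 then 1 else 0) + Complex.I ^ (k : ℕ) * ∏ l, if x l = 1 then 1 else 0
  | .X k, x => (∏ _l : L, 1 / (Real.sqrt 2 : ℂ)) +
      Complex.I ^ (k : ℕ) * ∏ l, (if x l = 0 then 1 else -1) / (Real.sqrt 2 : ℂ)
  | .H, x => (if ∀ l, x l = 1 then -1 else 1) / (Real.sqrt 2 : ℂ)

/-- A ZX diagram with set of boundary vertices `B`: a finite multigraph (parallel edges and loops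
are allowed) with vertex set `V ⊕ B`. An edge `e` has the two ends `(e, 0)` and `(e, 1)`; which one
is called `0` is immaterial. Hadamard boxes have degree two and boundary vertices degree one. -/
structure Diagram (B : Type) where
  V : Type
  E : Type
  [fintypeV : Fintype V]
  [fintypeE : Fintype E]
  node : V → Node
  ends : E × Fin 2 → V ⊕ B
  hadamard_degree : ∀ v, node v = Node.H → Nat.card {h : E × Fin 2 // ends h = Sum.inl v} = 2
  boundary_degree : ∀ b, ∃! h : E × Fin 2, ends h = Sum.inr b

attribute [instance] Diagram.fintypeV Diagram.fintypeE

/-- The two types of edge flips. -/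
inductive Flip where
  | X
  | Z

/-- A flip is the two-legged spider of its colour with phase `π`. -/
def Flip.node : Flip → Node
  | .X => Node.X 2
  | .Z => Node.Z 2

/-- The two-legged spider of a flip, as a matrix (the Pauli matrix `X` or `Z`). -/
noncomputable def Flip.matrix (t : Flip) : Matrix (Fin 2) (Fin 2) ℂ :=
  Matrix.of fun a b => t.node.coeff ![a, b]

namespace Diagram

variable {B : Type}

/-- An error is a set of edge flips. -/
abbrev Error (D : Diagram B) : Type := Finset (D.E × Flip)

open Classical in
/-- The weight of an error is the number of edges it affects. -/
noncomputable def weight (D : Diagram B) (ε : D.Error) : ℕ := (ε.image Prod.fst).card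

open Classical in
/-- The matrix on the edge `e` of `D + ε`: the flips of `ε` on `e`, composed. (The order of the two
flips only matters for the sign.) -/
noncomputable def edgeMatrix (D : Diagram B) (ε : D.Error) (e : D.E) : Matrix (Fin 2) (Fin 2) ℂ :=
  (if (e, Flip.X) ∈ ε then Flip.X.matrix else 1) * (if (e, Flip.Z) ∈ ε then Flip.Z.matrix else 1)

open Classical in
/-- The interpretation of `D + ε`, i.e. of `D` with the flips of `ε` inserted on its edges, as a
tensor on the boundary qubits: its coefficient at the labels `y` of the boundary is the sum, over
all labellings `x` of the ends of the edges that restrict to `y` on the boundary, of the product of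
the coefficients of all edges and vertices. Reading some boundary vertices as inputs and the others
as outputs, these are the matrix entries of the linear map of the diagram. -/
noncomputable def interpError (D : Diagram B) (ε : D.Error) (y : B → Fin 2) : ℂ :=
  ∑ x : D.E × Fin 2 → Fin 2,
    if ∀ h b, D.ends h = Sum.inr b → x h = y b then
      (∏ e, D.edgeMatrix ε e (x (e, 0)) (x (e, 1))) *
        ∏ v, (D.node v).coeff (fun h : {h : D.E × Fin 2 // D.ends h = Sum.inl v} => x h)
    else 0

/-- The interpretation of a diagram. -/
noncomputable def interp (D : Diagram B) : (B → Fin 2) → ℂ := D.interpError ∅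

end Diagram

/-- Equality of interpretations, up to a nonzero scalar. -/
def SameUpToScalar {Y : Type} (f g : Y → ℂ) : Prop := ∃ c : ℂ, c ≠ 0 ∧ f = c • g

namespace Diagram

variable {B : Type}

/-- An error is trivial if it does not change the interpretation. -/
def IsTrivial (D : Diagram B) (ε : D.Error) : Prop := SameUpToScalar (D.interpError ε) D.interp

/-- An error is detectable if it makes the interpretation zero. -/
def IsDetectable (D : Diagram B) (ε : D.Error) : Prop := D.interpError ε = 0

/-- The ZX distance: the minimum weight of the non-trivial undetectable errors (`⊤` if there are
none). -/
noncomputable def distance (D : Diagram B) : ℕ∞ :=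
  ⨅ (ε : D.Error) (_ : ¬ D.IsTrivial ε) (_ : ¬ D.IsDetectable ε), (D.weight ε : ℕ∞)

end Diagram

/-- A diagram with set of boundary vertices `P` in which every boundary edge has its other end at
a non-boundary vertex: `E` is the set of internal edges, and the boundary edge at `p : P` joins `p`
to the vertex `leg p`. Both sides of a rewrite are given in this form. -/
structure Pattern (P : Type) where
  V : Type
  E : Type
  [fintypeV : Fintype V]
  [fintypeE : Fintype E]
  node : V → Node
  ends : E × Fin 2 → V
  leg : P → V
  hadamard_degree : ∀ v, node v = Node.H →
    Nat.card {h : E × Fin 2 // ends h = v} + Nat.card {p : P // leg p = v} = 2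

attribute [instance] Pattern.fintypeV Pattern.fintypeE

namespace Pattern

variable {P : Type}

/-- The ends of the edges of the diagram of a pattern. -/
def diagramEnds (D : Pattern P) : (D.E ⊕ P) × Fin 2 → D.V ⊕ P
  | (.inl e, i) => .inl (D.ends (e, i))
  | (.inr p, 0) => .inl (D.leg p)
  | (.inr p, 1) => .inr p

theorem card_diagramEnds [Fintype P] (D : Pattern P) (v : D.V) :
    Nat.card {h // D.diagramEnds h = Sum.inl v} =
      Nat.card {h : D.E × Fin 2 // D.ends h = v} + Nat.card {p : P // D.leg p = v} := by
  rw [← Nat.card_sum]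
  refine (Nat.card_congr (Equiv.ofBijective
    (Sum.elim (fun h => ⟨(.inl h.1.1, h.1.2), congrArg Sum.inl h.2⟩)
      (fun p => ⟨(.inr p.1, 0), congrArg Sum.inl p.2⟩)) ⟨?_, ?_⟩)).symm
  · rintro (⟨⟨e, i⟩, h⟩ | ⟨p, h⟩) (⟨⟨e', i'⟩, h'⟩ | ⟨p', h'⟩) hh <;>
      replace hh := congrArg Subtype.val hh <;> simp_all
  · rintro ⟨⟨e | p, i⟩, h⟩
    · exact ⟨.inl ⟨(e, i), Sum.inl.inj h⟩, rfl⟩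
    · fin_cases i
      · exact ⟨.inr ⟨p, Sum.inl.inj h⟩, rfl⟩
      · exact (Sum.inr_ne_inl h).elim

/-- The diagram of a pattern, with its internal edges and its boundary edges. -/
def toDiagram [Fintype P] (D : Pattern P) : Diagram P where
  V := D.V
  E := D.E ⊕ P
  node := D.node
  ends := D.diagramEnds
  hadamard_degree v hv := (D.card_diagramEnds v).trans (D.hadamard_degree v hv)
  boundary_degree p := by
    refine ⟨(.inr p, 1), rfl, ?_⟩
    rintro ⟨e | q, i⟩ h
    · exact (Sum.inl_ne_inr h).elim
    · fin_cases i
      · exact (Sum.inl_ne_inr h).elim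
      · obtain rfl : q = p := Sum.inr.inj h
        rfl

end Pattern

namespace Diagram

variable {B P : Type}

/-- The new position of an end when a pattern is put into a context: an end at the port `p` moves
to the vertex of the pattern that carries the leg `p`. -/
def plugEnd (C : Diagram (B ⊕ P)) (D : Pattern P) :
    C.V ⊕ (B ⊕ P) → (C.V ⊕ D.V) ⊕ B
  | .inl v => .inl (.inl v)
  | .inr (.inl b) => .inr b
  | .inr (.inr p) => .inl (.inr (D.leg p))

/-- The ends of the edges after a pattern is put into a context. -/
def plugEnds (C : Diagram (B ⊕ P)) (D : Pattern P) :
    (C.E ⊕ D.E) × Fin 2 → (C.V ⊕ D.V) ⊕ B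
  | (.inl e, i) => C.plugEnd D (C.ends (e, i))
  | (.inr e, i) => .inl (.inr (D.ends (e, i)))

theorem card_plugEnds_inl (C : Diagram (B ⊕ P)) (D : Pattern P) (v : C.V) :
    Nat.card {h // C.plugEnds D h = Sum.inl (Sum.inl v)} =
      Nat.card {h // C.ends h = Sum.inl v} := by
  refine (Nat.card_congr (Equiv.ofBijective
    (fun h => ⟨(.inl h.1.1, h.1.2), congrArg (C.plugEnd D) h.2⟩) ⟨?_, ?_⟩)).symm
  · rintro ⟨⟨e, i⟩, h⟩ ⟨⟨e', i'⟩, h'⟩ hh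
    replace hh := congrArg Subtype.val hh
    simp_all
  · rintro ⟨⟨e | e, i⟩, h⟩
    · refine ⟨⟨(e, i), ?_⟩, rfl⟩
      rcases hx : C.ends (e, i) with w | b | p <;> simp_all [plugEnds, plugEnd]
    · simp [plugEnds] at h

theorem card_plugEnds_inr (C : Diagram (B ⊕ P)) (D : Pattern P) (v : D.V) :
    Nat.card {h // C.plugEnds D h = Sum.inl (Sum.inr v)} =
      Nat.card {h : D.E × Fin 2 // D.ends h = v} + Nat.card {p : P // D.leg p = v} := by
  choose port hport huniq using fun p : P => C.boundary_degree (Sum.inr p)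
  have hfin : Finite P := Finite.of_injective port fun p q hpq => by
    have h := hport p
    simp only [hpq] at h
    exact (Sum.inr.inj (Sum.inr.inj ((hport q).symm.trans h))).symm
  have hleg : ∀ p w, D.leg p = w →
      C.plugEnds D (.inl (port p).1, (port p).2) = Sum.inl (Sum.inr w) := fun p w hp =>
    (congrArg (C.plugEnd D) (hport p)).trans (congrArg (fun w => Sum.inl (Sum.inr w)) hp)
  rw [← Nat.card_sum]
  refine (Nat.card_congr (Equiv.ofBijective
    (Sum.elim (fun h => ⟨(.inr h.1.1, h.1.2), congrArg (fun w => Sum.inl (Sum.inr w)) h.2⟩)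
      (fun p => ⟨(.inl (port p.1).1, (port p.1).2), hleg p.1 v p.2⟩)) ⟨?_, ?_⟩)).symm
  · rintro (⟨⟨e, i⟩, h⟩ | ⟨p, h⟩) (⟨⟨e', i'⟩, h'⟩ | ⟨p', h'⟩) hh <;>
      replace hh := congrArg Subtype.val hh
    · simp_all
    · simp at hh
    · simp at hh
    · have hpq : port p = port p' := by
        simp only [Sum.elim_inr, Prod.mk.injEq, Sum.inl.injEq] at hh
        exact Prod.ext hh.1 hh.2
      have h1 := hport p
      simp only [hpq] at h1
      obtain rfl := Sum.inr.inj (Sum.inr.inj ((hport p').symm.trans h1))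
      rfl
  · rintro ⟨⟨e | e, i⟩, h⟩
    · rcases hx : C.ends (e, i) with w | b | p
      · simp [plugEnds, plugEnd, hx] at h
      · simp [plugEnds, plugEnd, hx] at h
      · have hp : D.leg p = v := by simpa [plugEnds, plugEnd, hx] using h
        have := huniq p (e, i) hx
        refine ⟨.inr ⟨p, hp⟩, ?_⟩
        simp [← this]
    · exact ⟨.inl ⟨(e, i), by simpa [plugEnds] using h⟩, rfl⟩

/-- The diagram in which the pattern `D` occurs in the context `C`. A context is a diagram with,
besides its boundary `B`, one port for every leg of the pattern; the edge of `C` at the port `p`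
becomes the edge at the leg `p` of the pattern. (An edge of `C` between two ports becomes an edge
between two legs of the pattern, and an edge between a port and a boundary vertex becomes a
boundary edge.) -/
def plug (C : Diagram (B ⊕ P)) (D : Pattern P) : Diagram B where
  V := C.V ⊕ D.V
  E := C.E ⊕ D.E
  node := Sum.elim C.node D.node
  ends := C.plugEnds D
  hadamard_degree v hv := by
    rcases v with v | v
    · exact (C.card_plugEnds_inl D v).trans (C.hadamard_degree v hv)
    · exact (C.card_plugEnds_inr D v).trans (D.hadamard_degree v hv)
  boundary_degree b := by
    obtain ⟨⟨e, i⟩, h, huniq⟩ := C.boundary_degree (Sum.inl b)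
    refine ⟨(.inl e, i), congrArg (C.plugEnd D) h, ?_⟩
    rintro ⟨e' | e', i'⟩ h'
    · have hx : C.ends (e', i') = Sum.inr (Sum.inl b) := by
        rcases hx : C.ends (e', i') with w | b' | p <;> simp_all [plugEnds, plugEnd]
      have := huniq (e', i') hx
      simp_all
    · simp [plugEnds] at h'

end Diagram

namespace Pattern

variable {P : Type} [Fintype P]

/-- The rewrite `D₁ → D₂` is distance non-decreasing: `D₁` and `D₂` have the same interpretation,
and replacing `D₁` by `D₂`, in any context, does not decrease the ZX distance. -/
def DistanceNonDecreasing (D₁ D₂ : Pattern P) : Prop :=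
  SameUpToScalar D₁.toDiagram.interp D₂.toDiagram.interp ∧
    ∀ (B : Type) (C : Diagram (B ⊕ P)), (C.plug D₁).distance ≤ (C.plug D₂).distance

/-- The rewrite `D₁ → D₂` is distance-preserving: it and its inverse are distance non-decreasing. -/
def DistancePreserving (D₁ D₂ : Pattern P) : Prop :=
  DistanceNonDecreasing D₁ D₂ ∧ DistanceNonDecreasing D₂ D₁

end Pattern

/-- The `n`-legged Z-spider (with phase zero). -/
def zSpider (n : ℕ) : Pattern (Fin n) where
  V := Unit
  E := Empty
  node _ := Node.Z 0
  ends h := h.1.elim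
  leg _ := ()
  hadamard_degree _ h := Node.noConfusion h

/-- For even `n`, the diagram of Z-spiders (with phase zero) that consists of two inner spiders
`inl 0`, `inl 1` and of `n / 2` outer spiders `inr i`. There is one internal edge `(i, s)` between
each outer spider `inr i` and each inner spider `inl s`, and the outer spider `inr i` carries the
legs `2 * i` and `2 * i + 1`. So inner spiders have `n / 2` legs and outer spiders have four. -/
def splitSpider (n : ℕ) (hn : Even n) : Pattern (Fin n) where
  V := Fin 2 ⊕ Fin (n / 2)
  E := Fin (n / 2) × Fin 2
  node _ := Node.Z 0
  ends h := if h.2 = 0 then Sum.inl h.1.2 else Sum.inr h.1.1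
  leg p := Sum.inr ⟨(p : ℕ) / 2, Nat.div_lt_div_of_lt_of_dvd (even_iff_two_dvd.mp hn) p.isLt⟩
  hadamard_degree _ h := Node.noConfusion h

end ZX

/-!
By linearity, the interpretation of a pattern in a context only depends on its tensor, and an error
on the legs of the pattern is an error on edges of the context of no larger weight. So it suffices
to see that every error on the internal edges of one pattern that does not annihilate its tensor
has, up to a scalar, the effect of a leg error of no larger weight on the tensor of the other.

The tensor of a phase-free Z-spider pattern is a sum over labellings of the spiders by bits. Without
flips, the labelling is constant and the tensor is `|0…0⟩ + |1…1⟩`. With flips, it jumps exactly at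
the `X` flips, so these form a cut, and they can be replaced by flips of the legs on one side of the
cut; on the cheaper side there are at most as many legs as cut edges. The `Z` flips only change the
relative sign of the two terms, which a single `Z` flip on any leg does too.

In the split spider, if the inner spiders are on different sides of a cut, each of the `n / 2` outer
spiders contributes one cut edge, and one of the sides has at most `n / 2` legs. If the inner
spiders are on the same side, each outer spider on the other side contributes two cut edges for its
two legs.
-/

namespace ZX

open scoped Finset symmDiff

theorem SameUpToScalar.symm {Y : Type} {f g : Y → ℂ} (h : SameUpToScalar f g) :
    SameUpToScalar g f := by
  obtain ⟨c, hc, rfl⟩ := h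
  exact ⟨c⁻¹, inv_ne_zero hc, (inv_smul_smul₀ hc g).symm⟩

theorem SameUpToScalar.trans {Y : Type} {f g h : Y → ℂ} (hfg : SameUpToScalar f g)
    (hgh : SameUpToScalar g h) : SameUpToScalar f h := by
  obtain ⟨c, hc, rfl⟩ := hfg
  obtain ⟨d, hd, rfl⟩ := hgh
  exact ⟨c * d, mul_ne_zero hc hd, smul_smul c d h⟩

theorem SameUpToScalar.eq_zero_iff {Y : Type} {f g : Y → ℂ} (h : SameUpToScalar f g) :
    f = 0 ↔ g = 0 := by
  obtain ⟨c, hc, rfl⟩ := h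
  exact smul_eq_zero_iff_right hc

theorem Node.coeff_comp_equiv {L L' : Type} [Fintype L] {_ : Fintype L'} (N : Node) (e : L ≃ L')
    (x : L' → Fin 2) : N.coeff (x ∘ e) = N.coeff x := by
  cases N with
  | Z k =>
    exact congrArg₂ (fun a b => a + Complex.I ^ (k : ℕ) * b)
      (e.prod_comp fun l => if x l = 0 then (1 : ℂ) else 0)
      (e.prod_comp fun l => if x l = 1 then (1 : ℂ) else 0)
  | X k =>
    exact congrArg₂ (fun a b => a + Complex.I ^ (k : ℕ) * b)
      (e.prod_comp fun _ => 1 / (Real.sqrt 2 : ℂ))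
      (e.prod_comp fun l => (if x l = 0 then 1 else -1) / (Real.sqrt 2 : ℂ))
  | H => simp only [Node.coeff, Function.comp_apply, e.forall_congr_left, Equiv.apply_symm_apply]

theorem Node.coeff_Z_zero {L : Type} [Fintype L] (x : L → Fin 2) :
    (Node.Z 0).coeff x = ∑ b : Fin 2, if ∀ l, x l = b then (1 : ℂ) else 0 := by
  simp only [Node.coeff, Fin.val_zero, pow_zero, one_mul, Fin.sum_univ_two, Finset.prod_ite_zero,
    Finset.mem_univ, true_implies, Finset.prod_const_one]

theorem Flip.matrix_X : Flip.X.matrix = !![0, 1; 1, 0] := by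
  have sqrt_mul_sqrt : (Real.sqrt 2 : ℂ) * Real.sqrt 2 = 2 := by
    rw [← Complex.ofReal_mul, Real.mul_self_sqrt zero_le_two, Complex.ofReal_ofNat]
  ext a b
  simp only [Flip.matrix, Flip.node, Node.coeff, Matrix.of_apply, Fin.prod_univ_two,
    div_mul_div_comm, sqrt_mul_sqrt, Fin.val_two, Complex.I_sq]
  fin_cases a <;> fin_cases b <;> norm_num

theorem Flip.matrix_Z : Flip.Z.matrix = !![1, 0; 0, -1] := by
  ext a b
  fin_cases a <;> fin_cases b <;> simp [Flip.matrix, Flip.node, Node.coeff]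

/-- The sign `(-1) ^ b`, the nontrivial character of the group of labels. -/
def sign (b : Fin 2) : ℂ := (-1) ^ (b : ℕ)

@[simp]
theorem sign_zero : sign 0 = 1 := by simp [sign]

@[simp]
theorem sign_one : sign 1 = -1 := by simp [sign]

theorem sign_add (a b : Fin 2) : sign (a + b) = sign a * sign b := by
  fin_cases a <;> fin_cases b <;> simp [sign]

theorem sign_ne_zero (b : Fin 2) : sign b ≠ 0 := pow_ne_zero _ (neg_ne_zero.2 one_ne_zero)

theorem prod_sign {A : Type} [Fintype A] (b : A → Fin 2) : ∏ a, sign (b a) = sign (∑ a, b a) := by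
  classical
  induction (Finset.univ : Finset A) using Finset.induction_on with
  | empty => simp
  | insert a s ha ih => rw [Finset.prod_insert ha, Finset.sum_insert ha, sign_add, ih]

theorem labelling_add_self {A : Type} (w : A → Fin 2) : w + w = 0 := by
  have label_add_self : ∀ b : Fin 2, b + b = 0 := by decide
  exact funext fun a => label_add_self (w a)

section Errors

variable {A A' : Type}

open Classical in
/-- The number of flips of type `t` on the edge `a`, as an element of the two-element group of
labels, so that the symmetric difference of errors corresponds to addition. -/
noncomputable def flipCount (ε : Finset (A × Flip)) (t : Flip) (a : A) : Fin 2 :=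
  if (a, t) ∈ ε then 1 else 0

theorem flipCount_eq_one_iff {ε : Finset (A × Flip)} {t : Flip} {a : A} :
    flipCount ε t a = 1 ↔ (a, t) ∈ ε := by
  simp [flipCount]

theorem flipCount_congr {ε : Finset (A × Flip)} {ε' : Finset (A' × Flip)} {t : Flip} {a : A}
    {a' : A'} (h : (a, t) ∈ ε ↔ (a', t) ∈ ε') : flipCount ε t a = flipCount ε' t a' := by
  classical
  exact if_congr h rfl rfl

@[simp]
theorem flipCount_empty (t : Flip) : flipCount (∅ : Finset (A × Flip)) t = 0 := by
  ext a
  simp [flipCount]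

open Classical in
theorem flipCount_symmDiff (ε ε' : Finset (A × Flip)) (t : Flip) (a : A) :
    flipCount (ε ∆ ε') t a = flipCount ε t a + flipCount ε' t a := by
  by_cases h : (a, t) ∈ ε <;> by_cases h' : (a, t) ∈ ε' <;>
    simp [flipCount, Finset.mem_symmDiff, h, h']

/-- The entry at `(b, c)` of the matrix on the edge `a` with the flips of `ε`, see
`Diagram.edgeMatrix_apply`. -/
noncomputable def flipCoeff (ε : Finset (A × Flip)) (a : A) (b c : Fin 2) : ℂ :=
  if b = c + flipCount ε .X a then sign (flipCount ε .Z a * c) else 0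

theorem Diagram.edgeMatrix_apply {B : Type} (D : Diagram B) (ε : D.Error) (e : D.E)
    (b c : Fin 2) : D.edgeMatrix ε e b c = flipCoeff ε e b c := by
  classical
  rw [Diagram.edgeMatrix, Flip.matrix_X, Flip.matrix_Z]
  by_cases hX : (e, Flip.X) ∈ ε <;> by_cases hZ : (e, Flip.Z) ∈ ε <;>
    simp only [hX, hZ, if_true, if_false, flipCoeff, flipCount] <;>
    fin_cases b <;> fin_cases c <;> simp

open Classical in
/-- The weight of an error on an arbitrary set of edges: the number of edges it affects. -/
noncomputable def errorWeight (ε : Finset (A × Flip)) : ℕ := #(ε.image Prod.fst)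

theorem errorWeight_pos {ε : Finset (A × Flip)} (h : ε.Nonempty) : 0 < errorWeight ε := by
  classical
  exact Finset.card_pos.2 (h.image _)

theorem card_le_errorWeight {ε : Finset (A × Flip)} {s : Finset A} {t : Flip}
    (h : ∀ a ∈ s, flipCount ε t a = 1) : #s ≤ errorWeight ε := by
  classical
  exact Finset.card_le_card fun a ha =>
    Finset.mem_image_of_mem Prod.fst (flipCount_eq_one_iff.1 (h a ha))

open Classical in
theorem errorWeight_symmDiff_le (ε ε' : Finset (A × Flip)) :
    errorWeight (ε ∆ ε') ≤ errorWeight ε + errorWeight ε' := by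
  refine (Finset.card_le_card ?_).trans (Finset.card_union_le _ _)
  rw [← Finset.image_union]
  exact Finset.image_subset_image symmDiff_le_sup

/-- The error obtained by restricting `ε` along an embedding of sets of edges. -/
noncomputable def comapError (f : A ↪ A') (ε : Finset (A' × Flip)) : Finset (A × Flip) :=
  ε.preimage (Prod.map f id) (f.injective.prodMap Function.injective_id).injOn

@[simp]
theorem mem_comapError {f : A ↪ A'} {ε : Finset (A' × Flip)} {a : A} {t : Flip} :
    (a, t) ∈ comapError f ε ↔ (f a, t) ∈ ε := by
  simp [comapError]

@[simp]
theorem comapError_empty (f : A ↪ A') : comapError f ∅ = ∅ := Finset.preimage_empty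

theorem flipCoeff_comapError (f : A ↪ A') (ε : Finset (A' × Flip)) (a : A) :
    flipCoeff (comapError f ε) a = flipCoeff ε (f a) := by
  funext b c
  simp only [flipCoeff, flipCount_congr mem_comapError]

theorem errorWeight_eq_add (ε : Finset ((A ⊕ A') × Flip)) :
    errorWeight ε = errorWeight (comapError .inl ε) + errorWeight (comapError .inr ε) := by
  classical
  rw [errorWeight, errorWeight, errorWeight, ← Finset.card_disjSum]
  congr 1
  ext (a | a) <;> simp

/-- The error obtained by moving `κ` along an embedding of sets of edges. -/
def mapError (f : A ↪ A') (κ : Finset (A × Flip)) : Finset (A' × Flip) :=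
  κ.map (f.prodMap (.refl Flip))

theorem flipCount_mapError_apply (f : A ↪ A') (κ : Finset (A × Flip)) (t : Flip) (a : A) :
    flipCount (mapError f κ) t (f a) = flipCount κ t a :=
  flipCount_congr (by simp [mapError])

theorem flipCount_mapError_of_notMem_range (f : A ↪ A') (κ : Finset (A × Flip)) (t : Flip)
    {a' : A'} (h : a' ∉ Set.range f) : flipCount (mapError f κ) t a' = 0 := by
  have notMem : (a', t) ∉ mapError f κ := by
    simp only [mapError, Finset.mem_map, Function.Embedding.coe_prodMap]
    rintro ⟨⟨a, t'⟩, -, hat⟩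
    exact h ⟨a, congrArg Prod.fst hat⟩
  simp [flipCount, notMem]

theorem errorWeight_mapError (f : A ↪ A') (κ : Finset (A × Flip)) :
    errorWeight (mapError f κ) = errorWeight κ := by
  classical
  rw [errorWeight, errorWeight, ← Finset.card_map f]
  simp only [mapError, Finset.map_eq_image, Finset.image_image]
  rfl

open Classical in
/-- The error on `A ⊕ A'` with the flips of `ε` on `A` and those of `ε'` on `A'`. -/
noncomputable def sumError (ε : Finset (A × Flip)) (ε' : Finset (A' × Flip)) :
    Finset ((A ⊕ A') × Flip) :=
  mapError .inl ε ∪ mapError .inr ε'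

@[simp]
theorem comapError_inl_sumError (ε : Finset (A × Flip)) (ε' : Finset (A' × Flip)) :
    comapError .inl (sumError ε ε') = ε := by
  ext ⟨a, t⟩
  simp [sumError, mapError]

@[simp]
theorem comapError_inr_sumError (ε : Finset (A × Flip)) (ε' : Finset (A' × Flip)) :
    comapError .inr (sumError ε ε') = ε' := by
  ext ⟨a, t⟩
  simp [sumError, mapError]

open Classical in
/-- The flips on edges that have the effect of the flips `κ` on the ends of the edges; equal flips
on the two ends of an edge cancel. -/
noncomputable def edgeFlips (κ : Finset ((A × Fin 2) × Flip)) : Finset (A × Flip) :=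
  comapError (.sectL A 0) κ ∆ comapError (.sectL A 1) κ

theorem flipCount_edgeFlips (κ : Finset ((A × Fin 2) × Flip)) (t : Flip) (a : A) :
    flipCount (edgeFlips κ) t a = flipCount κ t (a, 0) + flipCount κ t (a, 1) := by
  rw [edgeFlips, flipCount_symmDiff]
  exact congrArg₂ (· + ·) (flipCount_congr mem_comapError) (flipCount_congr mem_comapError)

theorem errorWeight_edgeFlips_le (κ : Finset ((A × Fin 2) × Flip)) :
    errorWeight (edgeFlips κ) ≤ errorWeight κ := by
  classical
  refine (Finset.card_le_card ?_).trans (Finset.card_image_le (f := Prod.fst))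
  intro a ha
  simp only [edgeFlips, Finset.mem_image, Finset.mem_symmDiff, Prod.exists, mem_comapError,
    Function.Embedding.sectL_apply] at ha ⊢
  aesop

open Classical in
/-- The factors `c a` are the signs that come from the anticommutation of `X` and `Z`. -/
theorem exists_flipCoeff_symmDiff_edgeFlips (ε : Finset (A × Flip))
    (κ : Finset ((A × Fin 2) × Flip)) :
    ∃ c : A → ℂ, (∀ a, c a ≠ 0) ∧ ∀ (x : A × Fin 2 → Fin 2) (a : A),
      flipCoeff (ε ∆ edgeFlips κ) a ((x + flipCount κ .X) (a, 0)) ((x + flipCount κ .X) (a, 1)) =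
        c a * (∏ i, sign (flipCount κ .Z (a, i) * x (a, i))) *
          flipCoeff ε a (x (a, 0)) (x (a, 1)) := by
  refine ⟨fun a => sign (flipCount κ .Z (a, 0) * flipCount ε .X a +
    flipCount (ε ∆ edgeFlips κ) .Z a * flipCount κ .X (a, 1)), fun a => sign_ne_zero _,
    fun x a => ?_⟩
  have support : ∀ b c s k l : Fin 2, b + k = c + l + (s + (k + l)) ↔ b = c + s := by decide
  have signs : ∀ c s k z m n : Fin 2, (z + (m + n)) * (c + k) =
      m * s + (z + (m + n)) * k + (m * (c + s) + n * c) + z * c := by decide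
  simp only [flipCoeff, flipCount_symmDiff, flipCount_edgeFlips, Fin.prod_univ_two, Pi.add_apply,
    support, mul_ite, mul_zero, ← sign_add]
  exact ite_congr rfl (fun h => by rw [h, ← signs]) fun _ => rfl

end Errors

section Labellings

variable {E E' : Type}

/-- The labelling of the ends of two sets of edges made of a labelling of the ends of each. -/
def joinLabelling (x : E × Fin 2 → Fin 2) (z : E' × Fin 2 → Fin 2) :
    (E ⊕ E') × Fin 2 → Fin 2 :=
  Sum.elim x z ∘ Equiv.sumProdDistrib E E' (Fin 2)

theorem sum_joinLabelling [Fintype (E × Fin 2 → Fin 2)] [Fintype (E' × Fin 2 → Fin 2)]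
    {_ : Fintype ((E ⊕ E') × Fin 2 → Fin 2)} (f : ((E ⊕ E') × Fin 2 → Fin 2) → ℂ) :
    ∑ x, f x = ∑ x, ∑ z, f (joinLabelling x z) := by
  rw [← Fintype.sum_prod_type']
  exact (((Equiv.sumProdDistrib E E' (Fin 2)).arrowCongr (Equiv.refl (Fin 2))).trans
    (Equiv.sumArrowEquivProdArrow _ _ _)).symm.sum_comp f |>.symm

end Labellings

open Classical in
/-- The tensor of a pattern with the flips of `η` on its internal edges: its coefficient at the
labels `w` of the legs is the sum over the labellings `x` of the ends of the internal edges. -/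
noncomputable def Pattern.tensor {P : Type} [Fintype P] (D : Pattern P)
    (η : Finset (D.E × Flip)) (w : P → Fin 2) : ℂ :=
  ∑ x : D.E × Fin 2 → Fin 2, (∏ e, flipCoeff η e (x (e, 0)) (x (e, 1))) *
    ∏ v, (D.node v).coeff (Sum.elim (fun h : {h : D.E × Fin 2 // D.ends h = v} => x h)
      (fun p : {p : P // D.leg p = v} => w p))

namespace Diagram

variable {B P : Type}

/-- The end at the port `p` of a context. -/
noncomputable def port (C : Diagram (B ⊕ P)) (p : P) : C.E × Fin 2 :=
  (C.boundary_degree (Sum.inr p)).choose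

theorem ends_port (C : Diagram (B ⊕ P)) (p : P) : C.ends (C.port p) = Sum.inr (Sum.inr p) :=
  (C.boundary_degree (Sum.inr p)).choose_spec.1

theorem eq_port (C : Diagram (B ⊕ P)) {p : P} {h : C.E × Fin 2}
    (hp : C.ends h = Sum.inr (Sum.inr p)) : h = C.port p :=
  (C.boundary_degree (Sum.inr p)).choose_spec.2 h hp

theorem port_injective (C : Diagram (B ⊕ P)) : Function.Injective C.port := fun p q h => by
  have ends_eq := C.ends_port p
  rw [h, C.ends_port q] at ends_eq
  exact (Sum.inr.inj (Sum.inr.inj ends_eq)).symm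

open Classical in
/-- The contraction of a context, with the flips of `ε` on its edges, with a tensor `T` on its
ports. -/
noncomputable def contract (C : Diagram (B ⊕ P)) (ε : C.Error) (T : (P → Fin 2) → ℂ)
    (y : B → Fin 2) : ℂ :=
  ∑ x : C.E × Fin 2 → Fin 2,
    if ∀ h b, C.ends h = Sum.inr (Sum.inl b) → x h = y b then
      (∏ e, flipCoeff ε e (x (e, 0)) (x (e, 1))) *
        (∏ v, (C.node v).coeff (fun h : {h : C.E × Fin 2 // C.ends h = Sum.inl v} => x h)) *
        T (fun p => x (C.port p))
    else 0

theorem contract_smul (C : Diagram (B ⊕ P)) (ε : C.Error) (c : ℂ) (T : (P → Fin 2) → ℂ) :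
    C.contract ε (c • T) = c • C.contract ε T := by
  classical
  funext y
  simp only [contract, Pi.smul_apply, smul_eq_mul, Finset.mul_sum, mul_ite, mul_zero]
  exact Finset.sum_congr rfl fun x _ => ite_congr rfl (fun _ => mul_left_comm _ _ _) fun _ => rfl

theorem contract_zero (C : Diagram (B ⊕ P)) (ε : C.Error) : C.contract ε 0 = 0 := by
  simpa only [zero_smul] using C.contract_smul ε 0 0

theorem plugEnd_eq_inr_iff (C : Diagram (B ⊕ P)) (D : Pattern P) {s : C.V ⊕ (B ⊕ P)} {b : B} :
    C.plugEnd D s = Sum.inr b ↔ s = Sum.inr (Sum.inl b) := by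
  rcases s with v | b' | p <;> simp [plugEnd]

theorem plugEnd_eq_inl_inl_iff (C : Diagram (B ⊕ P)) (D : Pattern P) {s : C.V ⊕ (B ⊕ P)}
    {v : C.V} : C.plugEnd D s = Sum.inl (Sum.inl v) ↔ s = Sum.inl v := by
  rcases s with v' | b | p <;> simp [plugEnd]

theorem plugEnd_eq_inl_inr_iff (C : Diagram (B ⊕ P)) (D : Pattern P) {s : C.V ⊕ (B ⊕ P)}
    {v : D.V} :
    C.plugEnd D s = Sum.inl (Sum.inr v) ↔ ∃ p, D.leg p = v ∧ s = Sum.inr (Sum.inr p) := by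
  rcases s with v' | b | p <;> simp [plugEnd]

/-- The ends at a vertex of the context, before and after plugging. -/
noncomputable def plugEndsEquivLeft (C : Diagram (B ⊕ P)) (D : Pattern P) (v : C.V) :
    {h // C.ends h = Sum.inl v} ≃ {h // C.plugEnds D h = Sum.inl (Sum.inl v)} :=
  Equiv.ofBijective
    (fun h => ⟨(.inl h.1.1, h.1.2), congrArg (C.plugEnd D) h.2⟩) (by
  constructor
  · rintro ⟨⟨e, i⟩, h⟩ ⟨⟨e', i'⟩, h'⟩ hh
    simpa using congrArg Subtype.val hh
  · rintro ⟨⟨e | e, i⟩, h⟩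
    · exact ⟨⟨(e, i), (C.plugEnd_eq_inl_inl_iff D).1 h⟩, rfl⟩
    · simp [plugEnds] at h)

/-- The ends at a vertex of the plugged pattern: those of its internal edges and, at the ports of
the context, those of its legs. -/
noncomputable def plugEndsEquivRight (C : Diagram (B ⊕ P)) (D : Pattern P) (v : D.V) :
    {h : D.E × Fin 2 // D.ends h = v} ⊕ {p : P // D.leg p = v} ≃
      {h // C.plugEnds D h = Sum.inl (Sum.inr v)} :=
  Equiv.ofBijective
    (Sum.elim (fun h => ⟨(.inr h.1.1, h.1.2), congrArg (fun w => Sum.inl (Sum.inr w)) h.2⟩)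
      (fun p => ⟨(.inl (C.port p.1).1, (C.port p.1).2),
        (C.plugEnd_eq_inl_inr_iff D).2 ⟨p.1, p.2, C.ends_port p.1⟩⟩)) (by
  constructor
  · rintro (⟨⟨e, i⟩, h⟩ | ⟨p, h⟩) (⟨⟨e', i'⟩, h'⟩ | ⟨p', h'⟩) hh <;>
      replace hh := congrArg Subtype.val hh
    · simpa using hh
    · simp at hh
    · simp at hh
    · simpa [← Prod.ext_iff, C.port_injective.eq_iff] using hh
  · rintro ⟨⟨e | e, i⟩, h⟩
    · obtain ⟨p, hp, hport⟩ := (C.plugEnd_eq_inl_inr_iff D).1 h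
      exact ⟨.inr ⟨p, hp⟩, by simp [← C.eq_port hport]⟩
    · exact ⟨.inl ⟨(e, i), Sum.inr.inj (Sum.inl.inj h)⟩, rfl⟩)

theorem plug_boundary_iff (C : Diagram (B ⊕ P)) (D : Pattern P) (x : C.E × Fin 2 → Fin 2)
    (z : D.E × Fin 2 → Fin 2) (y : B → Fin 2) :
    (∀ h b, C.plugEnds D h = Sum.inr b → joinLabelling x z h = y b) ↔
      ∀ h b, C.ends h = Sum.inr (Sum.inl b) → x h = y b := by
  constructor
  · exact fun h l b hb => h (.inl l.1, l.2) b ((C.plugEnd_eq_inr_iff D).2 hb)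
  · rintro h ⟨e | e, i⟩ b hb
    · exact h (e, i) b ((C.plugEnd_eq_inr_iff D).1 hb)
    · simp [plugEnds] at hb

theorem prod_plug_edges (C : Diagram (B ⊕ P)) (D : Pattern P)
    (ε : Finset ((C.E ⊕ D.E) × Flip)) (x : C.E × Fin 2 → Fin 2) (z : D.E × Fin 2 → Fin 2) :
    ∏ e, (C.plug D).edgeMatrix ε e (joinLabelling x z (e, 0)) (joinLabelling x z (e, 1)) =
      (∏ e, flipCoeff (comapError .inl ε) e (x (e, 0)) (x (e, 1))) *
        ∏ e, flipCoeff (comapError .inr ε) e (z (e, 0)) (z (e, 1)) := by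
  simp only [flipCoeff_comapError]
  exact (Finset.prod_congr rfl fun e _ => (C.plug D).edgeMatrix_apply ε e _ _).trans
    (Fintype.prod_sum_type _)

open Classical in
theorem prod_plug_vertices [Fintype P] (C : Diagram (B ⊕ P)) (D : Pattern P)
    (x : C.E × Fin 2 → Fin 2) (z : D.E × Fin 2 → Fin 2) :
    ∏ v, ((C.plug D).node v).coeff
        (fun h : {h // (C.plug D).ends h = Sum.inl v} => joinLabelling x z h.1) =
      (∏ v, (C.node v).coeff (fun h : {h // C.ends h = Sum.inl v} => x h)) *
        ∏ v, (D.node v).coeff (Sum.elim (fun h : {h // D.ends h = v} => z h)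
          (fun p : {p // D.leg p = v} => x (C.port p))) := by
  refine (Fintype.prod_sum_type _).trans (congrArg₂ (· * ·) ?_ ?_)
  · exact Finset.prod_congr rfl fun v _ =>
      (Node.coeff_comp_equiv (C.node v) (C.plugEndsEquivLeft D v) _).symm
  · refine Finset.prod_congr rfl fun v _ =>
      (Node.coeff_comp_equiv (D.node v) (C.plugEndsEquivRight D v) _).symm.trans
        (congrArg _ (funext fun l => ?_))
    rcases l with h | p <;> rfl

theorem interpError_plug [Fintype P] (C : Diagram (B ⊕ P)) (D : Pattern P)
    (ε : Finset ((C.E ⊕ D.E) × Flip)) :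
    (C.plug D).interpError ε = C.contract (comapError .inl ε) (D.tensor (comapError .inr ε)) := by
  classical
  funext y
  refine (sum_joinLabelling (E := C.E) (E' := D.E) _).trans ?_
  rw [contract]
  refine Finset.sum_congr rfl fun x _ => ?_
  split_ifs with hy
  · rw [Pattern.tensor, Finset.mul_sum]
    refine Finset.sum_congr rfl fun z _ =>
      (if_pos ((C.plug_boundary_iff D x z y).2 hy)).trans ?_
    refine (congrArg₂ (· * ·) (C.prod_plug_edges D ε x z) (C.prod_plug_vertices D x z)).trans ?_
    exact mul_mul_mul_comm _ _ _ _
  · exact Finset.sum_eq_zero fun z _ => if_neg (mt (C.plug_boundary_iff D x z y).1 hy)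

theorem interp_plug [Fintype P] (C : Diagram (B ⊕ P)) (D : Pattern P) :
    (C.plug D).interp = C.contract ∅ (D.tensor ∅) :=
  (C.interpError_plug D ∅).trans (by rw [comapError_empty, comapError_empty])

end Diagram

section Isomorphism

variable {B : Type}

theorem Diagram.interp_eq_of_equiv {D D' : Diagram B} (eV : D.V ≃ D'.V) (eE : D.E ≃ D'.E)
    (hnode : ∀ v, D'.node (eV v) = D.node v)
    (hends : ∀ e i, D'.ends (eE e, i) = Sum.map eV id (D.ends (e, i))) :
    D.interp = D'.interp := by
  classical
  let eH : D.E × Fin 2 ≃ D'.E × Fin 2 := eE.prodCongr (Equiv.refl (Fin 2))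
  have boundary_iff (h : D.E × Fin 2) (b : B) :
      D'.ends (eH h) = Sum.inr b ↔ D.ends h = Sum.inr b := by
    rw [show D'.ends (eH h) = _ from hends h.1 h.2]
    rcases D.ends (h.1, h.2) with v | b' <;> simp
  have vertex_iff (h : D.E × Fin 2) (v : D.V) :
      D.ends h = Sum.inl v ↔ D'.ends (eH h) = Sum.inl (eV v) := by
    rw [show D'.ends (eH h) = _ from hends h.1 h.2]
    rcases D.ends (h.1, h.2) with v' | b <;> simp
  funext y
  simp only [interp, interpError, edgeMatrix_apply, flipCoeff, flipCount_empty, Pi.zero_apply,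
    add_zero]
  rw [← (eH.arrowCongr (Equiv.refl (Fin 2))).symm.sum_comp]
  refine Finset.sum_congr rfl fun x _ => ite_congr (propext ?_) (fun _ => ?_) fun _ => rfl
  · rw [eH.symm.forall_congr_left]
    simp only [Equiv.symm_symm, boundary_iff]
    rfl
  · refine congrArg₂ (· * ·)
      (eE.prod_comp fun e => if x (e, 0) = x (e, 1) then sign (0 * x (e, 1)) else 0) ?_
    rw [← eV.prod_comp]
    refine Finset.prod_congr rfl fun v _ => ?_
    rw [hnode]
    let endsEquiv : {h // D.ends h = Sum.inl v} ≃ {h // D'.ends h = Sum.inl (eV v)} :=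
      eH.subtypeEquiv fun h => vertex_iff h v
    rw [← Node.coeff_comp_equiv (D.node v) endsEquiv]
    rfl

end Isomorphism

section LegErrors

variable {P : Type}

/-- The context that consists of a wire from each port to a boundary vertex; a pattern in it is
just the diagram of the pattern. -/
def idContext (P : Type) [Fintype P] : Diagram (P ⊕ P) where
  V := Empty
  E := P
  node := Empty.elim
  ends h := .inr (if h.2 = 0 then .inr h.1 else .inl h.1)
  hadamard_degree v := v.elim
  boundary_degree := by
    rintro (p | p)
    · refine ⟨(p, 1), rfl, ?_⟩
      rintro ⟨q, i⟩ h
      fin_cases i <;> simp_all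
    · refine ⟨(p, 0), rfl, ?_⟩
      rintro ⟨q, i⟩ h
      fin_cases i <;> simp_all

theorem Pattern.interp_toDiagram [Fintype P] (D : Pattern P) :
    D.toDiagram.interp = (idContext P).contract ∅ (D.tensor ∅) := by
  rw [← Diagram.interp_plug]
  refine Diagram.interp_eq_of_equiv (D := D.toDiagram) (D' := (idContext P).plug D)
    (Equiv.emptySum Empty D.V).symm (Equiv.sumComm D.E P) (fun v => rfl) ?_
  rintro (e | p) i
  · rfl
  · fin_cases i <;> rfl

/-- The tensor `T` with the flips of `κ` inserted on its legs. -/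
noncomputable def applyFlips [Fintype P] (κ : Finset (P × Flip)) (T : (P → Fin 2) → ℂ)
    (w : P → Fin 2) : ℂ :=
  (∏ p, sign (flipCount κ .Z p * w p)) * T (w + flipCount κ .X)

namespace Diagram

variable {B : Type} (C : Diagram (B ⊕ P))

/-- The flips on the ends at the ports of a context that correspond to the flips `κ` on the legs
of a plugged pattern. -/
noncomputable def portFlips (κ : Finset (P × Flip)) : Finset ((C.E × Fin 2) × Flip) :=
  mapError ⟨C.port, C.port_injective⟩ κ

theorem flipCount_portFlips_port (κ : Finset (P × Flip)) (t : Flip) (p : P) :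
    flipCount (C.portFlips κ) t (C.port p) = flipCount κ t p :=
  flipCount_mapError_apply ⟨C.port, C.port_injective⟩ κ t p

theorem flipCount_portFlips_of_notMem_range (κ : Finset (P × Flip)) (t : Flip)
    {h : C.E × Fin 2} (hh : h ∉ Set.range C.port) : flipCount (C.portFlips κ) t h = 0 :=
  flipCount_mapError_of_notMem_range ⟨C.port, C.port_injective⟩ κ t hh

theorem flipCount_portFlips_of_ends_eq (κ : Finset (P × Flip)) (t : Flip) {h : C.E × Fin 2}
    {s : C.V ⊕ (B ⊕ P)} (hs : C.ends h = s) (notPort : ∀ p, s ≠ Sum.inr (Sum.inr p)) :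
    flipCount (C.portFlips κ) t h = 0 := by
  refine C.flipCount_portFlips_of_notMem_range κ t ?_
  rintro ⟨p, rfl⟩
  exact notPort p (hs.symm.trans (C.ends_port p))

theorem prod_sign_portFlips [Fintype P] (κ : Finset (P × Flip)) (t : Flip)
    (x : C.E × Fin 2 → Fin 2) :
    ∏ e, ∏ i, sign (flipCount (C.portFlips κ) t (e, i) * x (e, i)) =
      ∏ p, sign (flipCount κ t p * x (C.port p)) := by
  rw [← Fintype.prod_prod_type fun h => sign (flipCount (C.portFlips κ) t h * x h)]
  refine (Fintype.prod_of_injective C.port C.port_injective _ _ (fun h hh => ?_) fun p => ?_).symm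
  · rw [C.flipCount_portFlips_of_notMem_range κ t hh, zero_mul, sign_zero]
  · rw [C.flipCount_portFlips_port]

open Classical in
theorem contract_symmDiff_portFlips [Fintype P] (ε : C.Error) (κ : Finset (P × Flip))
    (T : (P → Fin 2) → ℂ) :
    SameUpToScalar (C.contract (ε ∆ edgeFlips (C.portFlips κ)) T)
      (C.contract ε (applyFlips κ T)) := by
  obtain ⟨c, hc, hcoeff⟩ := exists_flipCoeff_symmDiff_edgeFlips ε (C.portFlips κ)
  refine ⟨∏ e, c e, Finset.prod_ne_zero_iff.2 fun e _ => hc e, funext fun y => ?_⟩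
  set shift : C.E × Fin 2 → Fin 2 := flipCount (C.portFlips κ) .X with shift_def
  have shift_eq_self {h : C.E × Fin 2} {s : C.V ⊕ (B ⊕ P)} (x : C.E × Fin 2 → Fin 2)
      (hs : C.ends h = s) (notPort : ∀ p, s ≠ Sum.inr (Sum.inr p)) : (x + shift) h = x h := by
    rw [Pi.add_apply, shift_def, C.flipCount_portFlips_of_ends_eq κ .X hs notPort, add_zero]
  have shift_vertex (x : C.E × Fin 2 → Fin 2) (v : C.V) :
      (fun l : {l // C.ends l = Sum.inl v} => (x + shift) l.1) = fun l => x l.1 :=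
    funext fun l => shift_eq_self x l.2 fun _ => Sum.inl_ne_inr
  have shift_port (x : C.E × Fin 2 → Fin 2) :
      (fun p => (x + shift) (C.port p)) = (fun p => x (C.port p)) + flipCount κ .X :=
    funext fun p => congrArg (x (C.port p) + ·) (C.flipCount_portFlips_port κ .X p)
  simp only [contract, Pi.smul_apply, smul_eq_mul, Finset.mul_sum, mul_ite, mul_zero]
  refine (Equiv.sum_comp (Equiv.addRight shift) _).symm.trans ?_
  refine Finset.sum_congr rfl fun x _ => ite_congr (propext (forall₂_congr fun h b =>
    imp_congr_right fun hb => ?_)) (fun _ => ?_) fun _ => rfl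
  · rw [Equiv.coe_addRight]
    exact iff_of_eq (congrArg (· = y b) (shift_eq_self x hb (by simp)))
  · simp only [Equiv.coe_addRight, shift_vertex, shift_port]
    simp only [hcoeff, Finset.prod_mul_distrib, prod_sign_portFlips, applyFlips]
    ring

open Classical in
theorem errorWeight_symmDiff_portFlips_le (ε : C.Error) (κ : Finset (P × Flip)) :
    errorWeight (ε ∆ edgeFlips (C.portFlips κ)) ≤ errorWeight ε + errorWeight κ :=
  (errorWeight_symmDiff_le _ _).trans (Nat.add_le_add_left
    ((errorWeight_edgeFlips_le _).trans_eq (errorWeight_mapError _ κ)) _)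

end Diagram

end LegErrors

section Distance

variable {B P : Type}

theorem Diagram.distance_le_of_forall_error {D D' : Diagram B}
    (interp_same : SameUpToScalar D.interp D'.interp)
    (h : ∀ ε' : D'.Error, ¬ D'.IsDetectable ε' → ∃ ε : D.Error, D.weight ε ≤ D'.weight ε' ∧
      SameUpToScalar (D.interpError ε) (D'.interpError ε')) :
    D.distance ≤ D'.distance := by
  refine le_iInf fun ε' => le_iInf fun nontrivial => le_iInf fun undetectable => ?_
  obtain ⟨ε, weight_le, same⟩ := h ε' undetectable
  refine (iInf_le_of_le ε (iInf₂_le (α := ℕ∞) (fun trivial => ?_) fun detectable => ?_)).trans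
    (Nat.cast_le.2 weight_le)
  · exact nontrivial ((same.symm.trans trivial).trans interp_same)
  · exact undetectable (same.eq_zero_iff.1 detectable)

theorem SameUpToScalar.contract {T T' : (P → Fin 2) → ℂ} (h : SameUpToScalar T T')
    (C : Diagram (B ⊕ P)) (ε : C.Error) :
    SameUpToScalar (C.contract ε T) (C.contract ε T') := by
  obtain ⟨c, hc, rfl⟩ := h
  exact ⟨c, hc, C.contract_smul ε c T'⟩

theorem Pattern.distanceNonDecreasing_of_forall_error [Fintype P] {D₁ D₂ : Pattern P}
    (tensor_same : SameUpToScalar (D₁.tensor ∅) (D₂.tensor ∅))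
    (h : ∀ η₂ : Finset (D₂.E × Flip), D₂.tensor η₂ ≠ 0 →
      ∃ (η₁ : Finset (D₁.E × Flip)) (κ : Finset (P × Flip)),
        errorWeight η₁ + errorWeight κ ≤ errorWeight η₂ ∧
          SameUpToScalar (applyFlips κ (D₁.tensor η₁)) (D₂.tensor η₂)) :
    DistanceNonDecreasing D₁ D₂ := by
  classical
  refine ⟨?_, fun B C => Diagram.distance_le_of_forall_error ?_ fun ε undetectable => ?_⟩
  · rw [interp_toDiagram, interp_toDiagram]
    exact tensor_same.contract _ ∅
  · rw [C.interp_plug, C.interp_plug]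
    exact tensor_same.contract C ∅
  · let εC : C.Error := comapError .inl ε
    have interpError_eq := C.interpError_plug D₂ ε
    have tensor_ne_zero : D₂.tensor (comapError .inr ε) ≠ 0 := fun tensor_eq_zero =>
      undetectable (by rw [Diagram.IsDetectable, interpError_eq, tensor_eq_zero, C.contract_zero])
    obtain ⟨η₁, κ, weight_le, same⟩ := h _ tensor_ne_zero
    refine ⟨sumError (εC ∆ edgeFlips (C.portFlips κ)) η₁, ?_, ?_⟩
    · have weightC_le := C.errorWeight_symmDiff_portFlips_le εC κ
      calc errorWeight (sumError (εC ∆ edgeFlips (C.portFlips κ)) η₁)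
          = errorWeight (εC ∆ edgeFlips (C.portFlips κ)) + errorWeight η₁ := by
            rw [errorWeight_eq_add, comapError_inl_sumError, comapError_inr_sumError]
        _ ≤ errorWeight εC + errorWeight (comapError .inr ε) := by lia
        _ = errorWeight ε := (errorWeight_eq_add ε).symm
    · rw [C.interpError_plug, interpError_eq, comapError_inl_sumError, comapError_inr_sumError]
      exact (C.contract_symmDiff_portFlips εC κ _).trans (same.contract C εC)

end Distance

section CatTensors

variable {P : Type}

/-- A tensor that is, up to a nonzero scalar, `|w⟩ + (-1) ^ b |w + 1⟩`, where `w + 1` is the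
bitwise complement of `w`: the state of a phase-free Z-spider, up to flips on its legs. -/
structure IsCatTensor (T : (P → Fin 2) → ℂ) (w : P → Fin 2) (b : Fin 2) : Prop where
  apply_ne_zero : T w ≠ 0
  apply_add_one : T (w + 1) = sign b * T w
  eq_or_eq_of_apply_ne_zero : ∀ {w'}, T w' ≠ 0 → w' = w ∨ w' = w + 1

namespace IsCatTensor

variable {T T' : (P → Fin 2) → ℂ} {w : P → Fin 2} {b : Fin 2}

theorem sameUpToScalar (h : IsCatTensor T w b) (h' : IsCatTensor T' w b) :
    SameUpToScalar T T' := by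
  refine ⟨T w / T' w, div_ne_zero h.apply_ne_zero h'.apply_ne_zero, funext fun w' => ?_⟩
  rw [Pi.smul_apply, smul_eq_mul]
  by_cases hw' : w' = w ∨ w' = w + 1
  · rcases hw' with rfl | rfl
    · rw [div_mul_cancel₀ _ h'.apply_ne_zero]
    · rw [h.apply_add_one, h'.apply_add_one, mul_left_comm,
        div_mul_cancel₀ _ h'.apply_ne_zero]
  · rw [not_imp_comm.1 h.eq_or_eq_of_apply_ne_zero hw',
      not_imp_comm.1 h'.eq_or_eq_of_apply_ne_zero hw', mul_zero]

theorem nonempty (h : IsCatTensor T w 1) : Nonempty P := by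
  by_contra! empty
  have apply_eq_neg := h.apply_add_one
  rw [Subsingleton.elim (w + 1) w, sign_one, neg_one_mul] at apply_eq_neg
  exact h.apply_ne_zero (self_eq_neg.1 apply_eq_neg)

theorem applyFlips [Fintype P] (h : IsCatTensor T w b) (κ : Finset (P × Flip)) :
    IsCatTensor (applyFlips κ T) (w + flipCount κ .X) (b + ∑ p, flipCount κ .Z p) := by
  have add_flips_cancel (u : P → Fin 2) : u + flipCount κ .X + flipCount κ .X = u := by
    rw [add_assoc, labelling_add_self, add_zero]
  refine ⟨?_, ?_, fun {w'} hw' => ?_⟩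
  · rw [ZX.applyFlips, add_flips_cancel]
    exact mul_ne_zero (Finset.prod_ne_zero_iff.2 fun _ _ => sign_ne_zero _) h.apply_ne_zero
  · rw [add_right_comm]
    simp only [ZX.applyFlips, add_flips_cancel, h.apply_add_one, sign_add, ← prod_sign,
      Pi.add_apply, Pi.one_apply, mul_add, mul_one, Finset.prod_mul_distrib]
    ring
  · rw [add_right_comm, ← add_flips_cancel w', add_left_inj, add_left_inj]
    exact h.eq_or_eq_of_apply_ne_zero (right_ne_zero_of_mul hw')

end IsCatTensor

theorem exists_flipCount_eq [Fintype P] (w z : P → Fin 2) :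
    ∃ κ : Finset (P × Flip), flipCount κ .X = w ∧ flipCount κ .Z = z ∧
      errorWeight κ ≤ #{p | w p = 1 ∨ z p = 1} := by
  classical
  let κ : Finset (P × Flip) :=
    ({p | w p = 1} : Finset P) ×ˢ {Flip.X} ∪ ({p | z p = 1} : Finset P) ×ˢ {Flip.Z}
  have eq_of_eq_one_iff : ∀ b c : Fin 2, (b = 1 ↔ c = 1) → b = c := by decide
  refine ⟨κ, funext fun p => eq_of_eq_one_iff _ _ ?_, funext fun p => eq_of_eq_one_iff _ _ ?_,
    Finset.card_le_card fun p hp => ?_⟩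
  · simp [flipCount_eq_one_iff, κ]
  · simp [flipCount_eq_one_iff, κ]
  · obtain ⟨⟨p, t⟩, hpt, rfl⟩ := Finset.mem_image.1 hp
    cases t <;> simp_all [κ]

/-- The `Z` flip is put on a leg with an `X` flip, if there is one, so that it costs nothing. -/
theorem exists_flipCount_X_eq_sum_flipCount_Z_eq [Fintype P] {w : P → Fin 2} {b : Fin 2} {m : ℕ}
    (card_le : #{p | w p = 1} ≤ m) (nonempty : b = 1 → Nonempty P) (pos : b = 1 → 0 < m) :
    ∃ κ : Finset (P × Flip), flipCount κ .X = w ∧ ∑ p, flipCount κ .Z p = b ∧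
      errorWeight κ ≤ m := by
  classical
  suffices ∃ z : P → Fin 2, ∑ p, z p = b ∧ #{p | w p = 1 ∨ z p = 1} ≤ m by
    obtain ⟨z, sum_eq, le⟩ := this
    obtain ⟨κ, hX, hZ, weight_le⟩ := exists_flipCount_eq w z
    exact ⟨κ, hX, hZ ▸ sum_eq, weight_le.trans le⟩
  obtain rfl | rfl : b = 0 ∨ b = 1 := by omega
  · exact ⟨0, by simp, by simpa using card_le⟩
  by_cases hw : ∃ q, w q = 1
  · obtain ⟨q, hq⟩ := hw
    refine ⟨Pi.single q 1, by simp, card_le.trans' (Finset.card_le_card fun p hp => ?_)⟩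
    by_cases hpq : p = q <;> simp_all
  · obtain ⟨q⟩ := nonempty rfl
    refine ⟨Pi.single q 1, by simp, (Finset.card_le_card fun p hp => ?_).trans
      ((Finset.card_singleton q).trans_le (pos rfl))⟩
    by_cases hpq : p = q <;> simp_all

end CatTensors

section PhaseFree

variable {P : Type}

namespace Pattern

/-- A pattern all of whose vertices are Z-spiders with phase zero. -/
def IsPhaseFree (D : Pattern P) : Prop := ∀ v, D.node v = Node.Z 0

/-- The cut of a two-colouring of the vertices: the internal edges between the two colours. -/
def cut (D : Pattern P) (β : D.V → Fin 2) : Finset D.E :=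
  {e | β (D.ends (e, 0)) ≠ β (D.ends (e, 1))}

/-- Every cut of a pattern has at least as many edges as there are legs on one of its two sides. -/
def IsLegExpander [Fintype P] (D : Pattern P) : Prop :=
  ∀ β : D.V → Fin 2, ∃ c : Fin 2, #{p | β (D.leg p) = c} ≤ #(D.cut β)

variable [Fintype P] {D : Pattern P}

open Classical in
theorem IsPhaseFree.tensor_eq_sum (hD : D.IsPhaseFree) (η : Finset (D.E × Flip))
    (w : P → Fin 2) :
    D.tensor η w = ∑ β : D.V → Fin 2, if β ∘ D.leg = w then
      ∏ e, flipCoeff η e (β (D.ends (e, 0))) (β (D.ends (e, 1))) else 0 := by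
  have vertices_eq (x : D.E × Fin 2 → Fin 2) :
      ∏ v, (D.node v).coeff (Sum.elim (fun h : {h : D.E × Fin 2 // D.ends h = v} => x h)
        (fun p : {p : P // D.leg p = v} => w p)) =
      ∑ β : D.V → Fin 2, if β ∘ D.leg = w ∧ x = β ∘ D.ends then (1 : ℂ) else 0 := by
    simp only [hD _, Node.coeff_Z_zero, Finset.prod_univ_sum, Fintype.piFinset_univ]
    refine Finset.sum_congr (by ext; simp) fun β _ => ?_
    rw [Finset.prod_ite_zero, Finset.prod_const_one]
    refine ite_congr (propext ?_) (fun _ => rfl) fun _ => rfl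
    simp only [Finset.mem_univ, true_implies, Sum.forall, Sum.elim_inl, Sum.elim_inr,
      Subtype.forall, forall_and, funext_iff, Function.comp_apply]
    aesop
  simp only [tensor, vertices_eq, Finset.mul_sum]
  rw [Finset.sum_comm]
  refine Finset.sum_congr rfl fun β _ => ?_
  simp [ite_and, Finset.sum_ite_irrel]

theorem IsPhaseFree.exists_of_tensor_ne_zero (hD : D.IsPhaseFree) {η : Finset (D.E × Flip)}
    {w : P → Fin 2} (hw : D.tensor η w ≠ 0) :
    ∃ β : D.V → Fin 2, β ∘ D.leg = w ∧
      ∀ e, β (D.ends (e, 0)) = β (D.ends (e, 1)) + flipCount η .X e := by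
  classical
  rw [hD.tensor_eq_sum] at hw
  obtain ⟨β, -, hβ⟩ := Finset.exists_ne_zero_of_sum_ne_zero hw
  obtain ⟨leg_eq, edges_ne_zero⟩ := ite_ne_right_iff.1 hβ
  exact ⟨β, leg_eq, fun e =>
    (ite_ne_right_iff.1 (Finset.prod_ne_zero_iff.1 edges_ne_zero e (Finset.mem_univ e))).1⟩

theorem IsPhaseFree.tensor_add_one (hD : D.IsPhaseFree) (η : Finset (D.E × Flip))
    (w : P → Fin 2) : D.tensor η (w + 1) = sign (∑ e, flipCount η .Z e) * D.tensor η w := by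
  classical
  rw [hD.tensor_eq_sum, hD.tensor_eq_sum, Finset.mul_sum, ← Equiv.sum_comp (Equiv.addRight 1)]
  refine Finset.sum_congr rfl fun β _ => ?_
  have leg_iff : (β + 1) ∘ D.leg = w + 1 ↔ β ∘ D.leg = w := by
    rw [show (β + 1) ∘ D.leg = β ∘ D.leg + 1 from rfl, add_left_inj]
  rw [mul_ite, mul_zero, Equiv.coe_addRight]
  refine if_congr leg_iff ?_ rfl
  rw [← prod_sign, ← Finset.prod_mul_distrib]
  refine Finset.prod_congr rfl fun e _ => ?_
  simp only [flipCoeff, Pi.add_apply, Pi.one_apply, add_right_comm _ (1 : Fin 2), add_left_inj,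
    mul_ite, mul_zero, mul_add, mul_one, sign_add]
  rw [mul_comm (sign _)]

theorem IsPhaseFree.tensor_empty_zero_ne_zero (hD : D.IsPhaseFree) : D.tensor ∅ 0 ≠ 0 := by
  classical
  simp only [hD.tensor_eq_sum, flipCoeff, flipCount_empty, Pi.zero_apply, add_zero, zero_mul,
    sign_zero, Finset.prod_ite_zero, Finset.prod_const_one, ← ite_and, Finset.sum_boole]
  exact Nat.cast_ne_zero.2 (Finset.card_ne_zero_of_mem (a := 0) (by simp))

theorem IsLegExpander.exists_leg_eq (hE : D.IsLegExpander) {β : D.V → Fin 2}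
    (hβ : ∀ e, β (D.ends (e, 0)) = β (D.ends (e, 1))) : ∃ c, ∀ p, β (D.leg p) = c := by
  obtain ⟨c, hc⟩ := hE β
  have cut_eq_empty : D.cut β = ∅ := Finset.filter_eq_empty_iff.2 fun e _ => not_not.2 (hβ e)
  rw [cut_eq_empty, Finset.card_empty, Nat.le_zero, Finset.card_eq_zero,
    Finset.filter_eq_empty_iff] at hc
  have eq_add_one : ∀ b c : Fin 2, b ≠ c → b = c + 1 := by decide
  exact ⟨c + 1, fun p => eq_add_one _ _ (hc (Finset.mem_univ p))⟩

theorem IsPhaseFree.isCatTensor (hD : D.IsPhaseFree) (hE : D.IsLegExpander)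
    {η : Finset (D.E × Flip)} {w : P → Fin 2} (hw : D.tensor η w ≠ 0) :
    IsCatTensor (D.tensor η) w (∑ e, flipCount η .Z e) := by
  refine ⟨hw, hD.tensor_add_one η w, fun {w'} hw' => ?_⟩
  obtain ⟨β, rfl, hβ⟩ := hD.exists_of_tensor_ne_zero hw
  obtain ⟨β', rfl, hβ'⟩ := hD.exists_of_tensor_ne_zero hw'
  have sum_eq : ∀ a b k : Fin 2, a + k + (b + k) = a + b := by decide
  obtain ⟨c, hc⟩ := hE.exists_leg_eq (β := β' + β) fun e => by
    rw [Pi.add_apply, hβ, hβ', sum_eq, Pi.add_apply]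
  have eq_of_add_eq : ∀ a b c : Fin 2, a + b = c → a = b + c := by decide
  have leg_eq (p : P) : β' (D.leg p) = β (D.leg p) + c := eq_of_add_eq _ _ _ (hc p)
  obtain rfl | rfl : c = 0 ∨ c = 1 := by omega
  · exact .inl (funext fun p => (leg_eq p).trans (add_zero _))
  · exact .inr (funext leg_eq)

/-- Undetected `X` flips contain the cut of a labelling of the spiders. -/
theorem IsPhaseFree.exists_tensor_ne_zero_card_le (hD : D.IsPhaseFree) (hE : D.IsLegExpander)
    {η : Finset (D.E × Flip)} (hη : D.tensor η ≠ 0) :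
    ∃ w, D.tensor η w ≠ 0 ∧ #{p | w p = 1} ≤ errorWeight η := by
  obtain ⟨w, hw⟩ := Function.ne_iff.1 hη
  obtain ⟨β, rfl, hβ⟩ := hD.exists_of_tensor_ne_zero hw
  have flip_of_mem_cut (e : D.E) (he : e ∈ D.cut β) : flipCount η .X e = 1 := by
    have eq_one_of_ne : ∀ b c k : Fin 2, b = c + k → b ≠ c → k = 1 := by decide
    exact eq_one_of_ne _ _ _ (hβ e) (Finset.mem_filter.1 he).2
  obtain ⟨c, hc⟩ := hE β
  have card_le := hc.trans (card_le_errorWeight flip_of_mem_cut)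
  obtain rfl | rfl : c = 0 ∨ c = 1 := by omega
  · refine ⟨β ∘ D.leg + 1, ?_, ?_⟩
    · rw [hD.tensor_add_one]
      exact mul_ne_zero (sign_ne_zero _) hw
    · simpa using card_le
  · exact ⟨β ∘ D.leg, hw, card_le⟩

theorem IsPhaseFree.exists_legFlips (hD : D.IsPhaseFree) (hE : D.IsLegExpander)
    {η : Finset (D.E × Flip)} (hη : D.tensor η ≠ 0) :
    ∃ κ : Finset (P × Flip), errorWeight κ ≤ errorWeight η ∧
      IsCatTensor (D.tensor η) (flipCount κ .X) (∑ p, flipCount κ .Z p) := by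
  obtain ⟨w, hw, card_le⟩ := hD.exists_tensor_ne_zero_card_le hE hη
  have cat := hD.isCatTensor hE hw
  have weight_pos (hsum : ∑ e, flipCount η .Z e = 1) : 0 < errorWeight η := by
    obtain ⟨e, -, he⟩ := Finset.exists_ne_zero_of_sum_ne_zero (hsum.trans_ne one_ne_zero)
    exact errorWeight_pos ⟨(e, .Z), flipCount_eq_one_iff.1 (Fin.eq_one_of_ne_zero _ he)⟩
  obtain ⟨κ, hX, hZ, weight_le⟩ := exists_flipCount_X_eq_sum_flipCount_Z_eq card_le
    (fun hsum => (hsum ▸ cat).nonempty) weight_pos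
  exact ⟨κ, weight_le, by rwa [hX, hZ]⟩

theorem IsPhaseFree.distanceNonDecreasing {D₁ D₂ : Pattern P} (hD₁ : D₁.IsPhaseFree)
    (hE₁ : D₁.IsLegExpander) (hD₂ : D₂.IsPhaseFree) (hE₂ : D₂.IsLegExpander) :
    DistanceNonDecreasing D₁ D₂ := by
  have cat₁ : IsCatTensor (D₁.tensor ∅) 0 0 := by
    simpa using hD₁.isCatTensor hE₁ hD₁.tensor_empty_zero_ne_zero
  have cat₂ : IsCatTensor (D₂.tensor ∅) 0 0 := by
    simpa using hD₂.isCatTensor hE₂ hD₂.tensor_empty_zero_ne_zero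
  refine distanceNonDecreasing_of_forall_error (cat₁.sameUpToScalar cat₂) fun η₂ hη₂ => ?_
  obtain ⟨κ, weight_le, cat⟩ := hD₂.exists_legFlips hE₂ hη₂
  have cat_applyFlips := cat₁.applyFlips κ
  rw [zero_add, zero_add] at cat_applyFlips
  exact ⟨∅, κ, by simpa [errorWeight] using weight_le, cat_applyFlips.sameUpToScalar cat⟩

end Pattern

end PhaseFree

section Spiders

theorem zSpider_isLegExpander (n : ℕ) : (zSpider n).IsLegExpander := fun β =>
  ⟨β () + 1, by simp [zSpider]⟩

theorem card_filter_val_div_two_le (n i : ℕ) : #{p : Fin n | (p : ℕ) / 2 = i} ≤ 2 := by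
  rw [← Finset.card_map Fin.valEmbedding]
  refine (Finset.card_le_card fun k hk => ?_).trans
    (Finset.card_le_two (a := 2 * i) (b := 2 * i + 1))
  obtain ⟨p, hp, rfl⟩ := Finset.mem_map.1 hk
  have div_eq : (p : ℕ) / 2 = i := (Finset.mem_filter.1 hp).2
  rw [Fin.valEmbedding_apply, Finset.mem_insert, Finset.mem_singleton]
  omega

theorem card_cut_splitSpider (n : ℕ) (hn : Even n) (β : (splitSpider n hn).V → Fin 2) :
    #((splitSpider n hn).cut β) = ∑ s, #{i | β (.inl s) ≠ β (.inr i)} := by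
  simp only [Pattern.cut, Finset.card_filter]
  exact Fintype.sum_prod_type_right _

theorem card_splitSpider_legs_le (n : ℕ) (hn : Even n) (β : (splitSpider n hn).V → Fin 2)
    (b : Fin 2) :
    #{p | β ((splitSpider n hn).leg p) = b + 1} ≤ 2 * #{i | b ≠ β (.inr i)} := by
  rw [← Finset.card_map (.inr : Fin (n / 2) ↪ Fin 2 ⊕ Fin (n / 2))]
  let leg : Fin n → Fin 2 ⊕ Fin (n / 2) := (splitSpider n hn).leg
  refine Finset.card_le_mul_card_image_of_maps_to (f := leg) (fun p hp => ?_) 2 fun v hv => ?_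
  · have ne_add_one : b ≠ b + 1 := (add_ne_left.2 one_ne_zero).symm
    refine Finset.mem_map_of_mem _ (Finset.mem_filter.2 ⟨Finset.mem_univ _, ?_⟩)
    rwa [← (Finset.mem_filter.1 hp).2] at ne_add_one
  · obtain ⟨i, -, rfl⟩ := Finset.mem_map.1 hv
    refine (Finset.card_le_card fun p hp => ?_).trans (card_filter_val_div_two_le n i)
    exact Finset.mem_filter.2 ⟨Finset.mem_univ p,
      congrArg Fin.val (Sum.inr.inj (Finset.mem_filter.1 hp).2)⟩

/-- Averaging over the two inner spiders `inl s`: an outer spider of the colour opposite to `inl s`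
has two legs and a cut edge to `inl s`. -/
theorem splitSpider_isLegExpander (n : ℕ) (hn : Even n) :
    (splitSpider n hn).IsLegExpander := by
  intro β
  have sum_le : ∑ s : Fin 2, #{p | β ((splitSpider n hn).leg p) = β (.inl s) + 1} ≤
      ∑ _s : Fin 2, #((splitSpider n hn).cut β) :=
    calc _ ≤ ∑ s : Fin 2, 2 * #{i | β (.inl s) ≠ β (.inr i)} :=
          Finset.sum_le_sum fun s _ => card_splitSpider_legs_le n hn β (β (.inl s))
      _ = ∑ _s : Fin 2, #((splitSpider n hn).cut β) := by
          rw [← Finset.mul_sum, ← card_cut_splitSpider, Finset.sum_const, Finset.card_univ,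
            Fintype.card_fin, smul_eq_mul]
  obtain ⟨s, -, hs⟩ := Finset.exists_le_of_sum_le Finset.univ_nonempty sum_le
  exact ⟨β (.inl s) + 1, hs⟩

end Spiders

end ZX

theorem mainTheorem3_general {P : Type} [Fintype P] {D₁ D₂ : ZX.Pattern P}
    (hD₁ : D₁.IsPhaseFree) (hE₁ : D₁.IsLegExpander) (hD₂ : D₂.IsPhaseFree)
    (hE₂ : D₂.IsLegExpander) : ZX.Pattern.DistancePreserving D₁ D₂ :=
  ⟨hD₁.distanceNonDecreasing hE₁ hD₂ hE₂, hD₂.distanceNonDecreasing hE₂ hD₁ hE₁⟩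

theorem mainTheorem3 (n : ℕ) (hn : Even n) :
    ZX.Pattern.DistancePreserving (ZX.zSpider n) (ZX.splitSpider n hn) := by
  exact mainTheorem3_general (fun _ => rfl) (ZX.zSpider_isLegExpander n)
    (fun _ => rfl) (ZX.splitSpider_isLegExpander n hn)
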